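/- Let $q\ge 2$ and $k$ be integers with $8\le 2k+2$ (that is, $k\ge 3$), and let $I,J$ be disjoint sets with $I\cup J=\mathbb{Z}_q=\{0,1,\dots,q-1\}$ and $|I|=|J|$. A word $(x_1,\dots,x_r)$ over $\mathbb{Z}_q$ is called $(I^k\cup J^k)$-free if no $k$ consecutive letters of it all lie in $I$ and no $k$ consecutive letters of it all lie in $J$. For $i\ge 2k+2$ let $V_{I,J}^{(k)}(i)$ be the set of all words $(v_1,\dots,v_i)\in\mathbb{Z}_q^i$ such that - $(v_1,\dots,v_k)\in J^k$, $v_{k+1}\in I$, $v_{i-k}\in J$, and $(v_{i-k+1},\dots,v_i)\in I^k$; - $(v_{k+1},\dots,v_{i-k})$ is $(I^k\cup J^k)$-free. For $n\ge 2k+2$ let $\mathcal{V}_{I,J}^{(k)}(n)=\bigcup_{i=2k+2}^{n}V_{I,J}^{(k)}(i)$. For an integer $m\ge 2$ put $$\epsilon_m=\sum_{i\ge 1}\binom{(m+1)i-2}{i-1}\frac{1}{i\,2^{(m+1)i}} .$$ Then the series defining $\epsilon_{k-1}$ converges, and $$\limsup_{n\to\infty}\bigl|\mathcal{V}_{I,J}^{(k)}(n)\bigr|^{1/n}=q\,(1-\epsilon_{k-1}).$$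 -/

import Mathlib

namespace NonOverlapping

/-- `A^k`: the words of length `k` all of whose letters belong to `A`. -/
def pow {α : Type*} (A : Set α) (k : ℕ) : Set (List α) :=
  {w | w.length = k ∧ ∀ a ∈ w, a ∈ A}

/-- For a set `C` of words of length `k`, the word `x` is `C`-free if none of the windows
`(x_i, …, x_{i+k-1})` of `x` is in `C`; in particular every word shorter than `k` is `C`-free. -/
def IsFree {α : Type*} (k : ℕ) (C : Set (List α)) (x : List α) : Prop :=
  ∀ i : ℕ, i + k ≤ x.length → (x.drop i).take k ∉ C

/-- The words `v = (v_1, …, v_n)` of length `n` over `{0, …, q-1}` such that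
`(v_1, …, v_k) ∈ J^k`, `v_{k+1} ∈ I`, `v_{n-k} ∈ J`, `(v_{n-k+1}, …, v_n) ∈ I^k` and
`(v_{k+1}, …, v_{n-k})` is `(I^k ∪ J^k)`-free. It is only used for `2 * k + 2 ≤ n`.
Positions are counted from `0` in the code: `v_{j+1}` is `v[j]?`. -/
def block {q : ℕ} (I J : Set (Fin q)) (k n : ℕ) : Set (List (Fin q)) :=
  {v | v.length = n ∧
    v.take k ∈ pow J k ∧
    (∃ a ∈ v[k]?, a ∈ I) ∧
    (∃ b ∈ v[n - k - 1]?, b ∈ J) ∧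
    v.drop (n - k) ∈ pow I k ∧
    IsFree k (pow I k ∪ pow J k) ((v.drop k).take (n - 2 * k))}

/-- The variable-length code with maximum length `n`: the union of the sets `block I J k i`
over `2 * k + 2 ≤ i ≤ n`. -/
def code {q : ℕ} (I J : Set (Fin q)) (k n : ℕ) : Set (List (Fin q)) :=
  ⋃ i ∈ Set.Icc (2 * k + 2) n, block I J k i

/-- The code is a finite set, so that `Set.ncard` is its number of codewords. -/
theorem code_finite {q : ℕ} (I J : Set (Fin q)) (k n : ℕ) : (code I J k n).Finite := by
  refine (List.finite_length_le (Fin q) n).subset ?_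
  intro v hv
  simp only [code, Set.mem_iUnion] at hv
  obtain ⟨i, hi, hv⟩ := hv
  exact hv.1.le.trans hi.2

/-- The term of index `i ≥ 1` of the series for `ε_k`. -/
noncomputable def epsilonTerm (k i : ℕ) : ℝ :=
  (Nat.choose ((k + 1) * i - 2) (i - 1) : ℝ) * (1 / ((i : ℝ) * 2 ^ ((k + 1) * i)))

/-- `ε_k = ∑_{i ≥ 1} ((k+1)i - 2 choose i - 1) / (i 2^{(k+1)i})`, the index being shifted by one. -/
noncomputable def epsilon (k : ℕ) : ℝ :=
  ∑' i : ℕ, epsilonTerm k (i + 1)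

end NonOverlapping

/-!
Write `m = k - 1`, `h = |I| = |J|`, so that `q = 2h`, and `φ = 2 (1 - ε_m)`. The claim is that the
number of codewords of length at most `n` grows like `(h φ) ^ n`.

**The number `φ`.** Put `t = 2 ^ (-(m + 1))`. The terms of `ε_m` are `t ^ (i + 1)` times Raney
(Fuss–Catalan) numbers, and the latter are the coefficients of `B(t) ^ m`, where
`B = 1 + t B ^ (m + 1)`; hence `ε_m = t B ^ m = 1 - 1 / B` and `φ = 2 / B`. Instead of appealing to
Lagrange inversion, the coefficients of `B ^ x` are defined by the recursion that expresses
`B ^ (x + 1) = B ^ x + t B ^ (x + m + 1)` (`raney`). The closed form (`succ_mul_raney`) and the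
multiplicativity in `x` (`raney_add`) follow by induction, and the supersolution `3 / 2` of the
equation for `B` bounds all partial sums (`sum_raney_le`), so that the series converge and
`1 < B ≤ 3 / 2`. The equation for `B` becomes `(2 - φ) φ ^ m = 1` with `1 < φ < 2`
(`two_mul_one_sub_epsilon`): `φ` is the growth rate of compositions with parts at most `m`.

**Counting.** A word is free exactly if its runs of letters on one side of `{I, J}` are shorter than
`k`. Reading the middle part of a codeword from left to right, only the side `s` and the length `r`
of the current run matter, and the number `N(s, r, L)` of admissible continuations of length `L`
satisfies `N(s, r, L + 1) = h (N(s, r + 1, L) + N(¬s, 1, L))`, without the first summand if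
`r + 1 = k` (`ncard_continuations_succ`). The potential `p r = φ - (2 - φ) φ ^ r` satisfies
`φ p r = p (r + 1) + p 1` and `p k = 0`, so `p r (h φ) ^ L` solves the same recursion; as `p` is
positive and bounded for `1 ≤ r < k`, it bounds `N` from both sides up to constant factors
(`ncard_continuations_le`, `le_ncard_continuations`). Summing over the block lengths costs only a
factor `n`, and taking `n`-th roots gives a genuine limit `h φ = q (1 - ε_m)`.
-/

namespace NonOverlapping

/-! ### Raney numbers and the series `ε_m` -/

/-- The coefficient of `t ^ n` in `B ^ x`, where `B = 1 + t B ^ z`. The recursion is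
`B ^ (x + 1) = B ^ x + t B ^ (x + z)`; in closed form it is `x / (x + n z) * (x + n z).choose n`,
see `succ_mul_raney`. -/
def raney (z : ℕ) : ℕ → ℕ → ℕ
  | 0, _ => 1
  | _ + 1, 0 => 0
  | n + 1, x + 1 => raney z (n + 1) x + raney z n (x + z)
termination_by n x => (n, x)

theorem raney_zero (z x : ℕ) : raney z 0 x = 1 := by
  rw [raney]

theorem raney_succ_zero (z n : ℕ) : raney z (n + 1) 0 = 0 := by
  rw [raney]

theorem raney_succ_succ (z n x : ℕ) :
    raney z (n + 1) (x + 1) = raney z (n + 1) x + raney z n (x + z) := by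
  rw [raney]

/-- The coefficient form of `B ^ (x + y) = B ^ x * B ^ y`. -/
theorem raney_add (z n x y : ℕ) :
    raney z n (x + y) =
      ∑ p ∈ Finset.HasAntidiagonal.antidiagonal n, raney z p.1 x * raney z p.2 y := by
  induction n generalizing x with
  | zero => simp [raney_zero]
  | succ n ihn =>
    induction x with
    | zero =>
      simp [Finset.Nat.antidiagonal_succ, raney_zero, raney_succ_zero]
    | succ x ihx =>
      rw [show x + 1 + y = (x + y) + 1 by ring, raney_succ_succ, ihx,
        show x + y + z = (x + z) + y by ring, ihn]
      simp only [Finset.Nat.antidiagonal_succ, Finset.sum_cons, Finset.sum_map,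
        Function.Embedding.prodMap, Function.Embedding.coeFn_mk, Prod.map, raney_zero,
        raney_succ_succ, add_mul, Finset.sum_add_distrib]
      simp [add_assoc]

theorem succ_mul_raney {z : ℕ} (hz : 1 ≤ z) (n x : ℕ) :
    (n + 1) * raney z (n + 1) x = x * (x + (n + 1) * z - 1).choose n := by
  induction n generalizing x with
  | zero =>
    induction x with
    | zero => simp [raney_succ_zero]
    | succ x ih => simp_all [raney_succ_succ, raney_zero]
  | succ n ihn =>
    induction x with
    | zero => simp [raney_succ_zero]
    | succ x ih =>
      have h := ihn (x + z)
      obtain ⟨M, hM⟩ : ∃ M, x + (n + 2) * z = M + 1 :=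
        ⟨x + (n + 2) * z - 1, by have : 1 ≤ (n + 2) * z := Nat.mul_pos (by omega) hz
                                 omega⟩
      rw [show x + z + (n + 1) * z = x + (n + 2) * z by ring, hM] at h
      rw [show n + 1 + 1 = n + 2 from rfl, hM] at ih
      rw [raney_succ_succ, show n + 1 + 1 = n + 2 from rfl,
        show x + 1 + (n + 2) * z = x + (n + 2) * z + 1 by ring, hM]
      simp only [Nat.add_sub_cancel] at h ih ⊢
      have hc := Nat.choose_succ_right_eq M n
      have hle : n ≤ M := by nlinarith
      rw [Nat.choose_succ_succ]
      -- The factor `n + 1` clears the denominator in the absorption identity `hc`.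
      refine Nat.eq_of_mul_eq_mul_left (Nat.succ_pos n) ?_
      zify [hle] at *
      linear_combination (n + 1 : ℤ) * ih + (n + 2 : ℤ) * h - hc +
        (M.choose n : ℤ) * hM

/-- The coefficients of `B ^ m` for `z = m + 1` are those in the series for `ε_m`. -/
theorem succ_mul_raney_pred {m : ℕ} (hm : 1 ≤ m) (i : ℕ) :
    (i + 1) * raney (m + 1) i m = ((m + 1) * (i + 1) - 2).choose i := by
  cases i with
  | zero => simp [raney_zero]
  | succ n =>
    have h := succ_mul_raney (Nat.le_add_left 1 m) n m
    have e : (m + 1) * (n + 1 + 1) - 2 = m + (n + 1) * (m + 1) - 1 := by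
      have : (m + 1) * (n + 1 + 1) = m + (n + 1) * (m + 1) + 1 := by ring
      omega
    have hc := Nat.choose_succ_right_eq (m + (n + 1) * (m + 1) - 1) n
    have e2 : m + (n + 1) * (m + 1) - 1 - n = m * (n + 2) := by
      have : m + (n + 1) * (m + 1) = m * (n + 2) + n + 1 := by ring
      omega
    rw [e2] at hc
    rw [e]
    refine Nat.eq_of_mul_eq_mul_left (Nat.succ_pos n) ?_
    rw [Nat.succ_eq_add_one]
    linear_combination (n + 2) * h - hc

/-- A supersolution `b` of the equation `B = 1 + t B ^ z` bounds the partial sums of the series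
for `B ^ x`, uniformly in the number of terms. -/
theorem sum_raney_le {z : ℕ} {t b : ℝ} (ht : 0 ≤ t) (hb : 0 ≤ b) (h : 1 + t * b ^ z ≤ b)
    (n x : ℕ) : ∑ j ∈ Finset.range (n + 1), (raney z j x : ℝ) * t ^ j ≤ b ^ x := by
  have hb1 : 1 ≤ b := by linarith [mul_nonneg ht (pow_nonneg hb z)]
  induction n generalizing x with
  | zero => simpa [raney_zero] using one_le_pow₀ hb1
  | succ n ihn =>
    induction x with
    | zero => simp [Finset.sum_range_succ', raney_zero, raney_succ_zero]
    | succ x ihx =>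
      rw [Finset.sum_range_succ'] at ihx ⊢
      calc _ = (∑ j ∈ Finset.range (n + 1), (raney z (j + 1) x : ℝ) * t ^ (j + 1) +
              (raney z 0 x : ℝ) * t ^ 0) +
              t * ∑ j ∈ Finset.range (n + 1), (raney z j (x + z) : ℝ) * t ^ j := by
            simp only [raney_succ_succ, raney_zero, Nat.cast_add, add_mul,
              Finset.sum_add_distrib, Finset.mul_sum, pow_succ]
            have : ∀ j, (raney z j (x + z) : ℝ) * (t ^ j * t) =
              t * (raney z j (x + z) * t ^ j) := fun j => by ring
            simp only [this]
            ring
        _ ≤ b ^ x + t * b ^ (x + z) := add_le_add ihx (mul_le_mul_of_nonneg_left (ihn _) ht)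
        _ = b ^ x * (1 + t * b ^ z) := by ring
        _ ≤ b ^ x * b := mul_le_mul_of_nonneg_left h (pow_nonneg hb x)
        _ = b ^ (x + 1) := (pow_succ b x).symm

theorem summable_raney {z : ℕ} {t b : ℝ} (ht : 0 ≤ t) (hb : 0 ≤ b) (h : 1 + t * b ^ z ≤ b)
    (x : ℕ) : Summable fun j => (raney z j x : ℝ) * t ^ j := by
  refine summable_of_sum_range_le (c := b ^ x) (fun j => by positivity) fun n => ?_
  refine le_trans ?_ (sum_raney_le ht hb h n x)
  exact Finset.sum_le_sum_of_subset_of_nonneg (Finset.range_mono n.le_succ)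
    fun j _ _ => by positivity

theorem tsum_raney_add {z : ℕ} {t b : ℝ} (ht : 0 ≤ t) (hb : 0 ≤ b) (h : 1 + t * b ^ z ≤ b)
    (x y : ℕ) : ∑' j, (raney z j (x + y) : ℝ) * t ^ j =
      (∑' j, (raney z j x : ℝ) * t ^ j) * ∑' j, (raney z j y : ℝ) * t ^ j := by
  rw [tsum_mul_tsum_eq_tsum_sum_antidiagonal_of_summable_norm
    (summable_raney ht hb h x).norm (summable_raney ht hb h y).norm]
  refine tsum_congr fun n => ?_
  rw [raney_add, Nat.cast_sum, Finset.sum_mul]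
  refine Finset.sum_congr rfl fun p hp => ?_
  rw [← Finset.HasAntidiagonal.mem_antidiagonal.1 hp]
  push_cast
  ring

theorem tsum_raney_eq_pow {z : ℕ} {t b : ℝ} (ht : 0 ≤ t) (hb : 0 ≤ b) (h : 1 + t * b ^ z ≤ b)
    (x : ℕ) : ∑' j, (raney z j x : ℝ) * t ^ j = (∑' j, (raney z j 1 : ℝ) * t ^ j) ^ x := by
  induction x with
  | zero =>
    rw [tsum_eq_single 0 fun j hj => ?_]
    · simp [raney_zero]
    · obtain ⟨i, rfl⟩ := Nat.exists_eq_succ_of_ne_zero hj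
      simp [raney_succ_zero]
  | succ x ih => rw [tsum_raney_add ht hb h, ih, pow_succ]

/-- The sum `B` of the series satisfies the functional equation `B = 1 + t B ^ z`. -/
theorem tsum_raney_one {z : ℕ} {t b : ℝ} (ht : 0 ≤ t) (hb : 0 ≤ b) (h : 1 + t * b ^ z ≤ b) :
    ∑' j, (raney z j 1 : ℝ) * t ^ j = 1 + t * (∑' j, (raney z j 1 : ℝ) * t ^ j) ^ z := by
  rw [← tsum_raney_eq_pow ht hb h z, (summable_raney ht hb h 1).tsum_eq_zero_add, ← tsum_mul_left]
  simp only [raney_zero, pow_zero, Nat.cast_one, mul_one]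
  congr 1
  refine tsum_congr fun j => ?_
  rw [raney_succ_succ z j 0, raney_succ_zero, zero_add, zero_add, pow_succ]
  ring

theorem epsilonTerm_eq_raney {m : ℕ} (hm : 1 ≤ m) (i : ℕ) :
    epsilonTerm m (i + 1) = (1 / 2) ^ (m + 1) * (raney (m + 1) i m * ((1 / 2) ^ (m + 1)) ^ i) := by
  have h : ((i : ℝ) + 1) * raney (m + 1) i m = (((m + 1) * (i + 1) - 2).choose i : ℕ) := by
    exact_mod_cast succ_mul_raney_pred hm i
  have hi : (i : ℝ) + 1 ≠ 0 := by positivity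
  rw [epsilonTerm, Nat.add_sub_cancel, ← h, ← pow_mul, mul_left_comm, ← pow_add,
    show m + 1 + (m + 1) * i = (m + 1) * (i + 1) by ring, one_div_pow]
  push_cast
  field_simp

/-- The number `3 / 2` is a supersolution of `B = 1 + t B ^ (m + 1)` at `t = 2 ^ (-(m + 1))`. It lies
below the solution `2`, which corresponds to the extraneous root `φ = 1`. -/
theorem half_pow_supersolution {m : ℕ} (hm : 2 ≤ m) :
    1 + (1 / 2 : ℝ) ^ (m + 1) * (3 / 2) ^ (m + 1) ≤ 3 / 2 := by
  have : (3 / 4 : ℝ) ^ (m + 1) ≤ (3 / 4) ^ 3 :=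
    pow_le_pow_of_le_one (by norm_num) (by norm_num) (by omega)
  rw [← mul_pow]
  norm_num at this ⊢
  linarith

theorem summable_epsilonTerm {m : ℕ} (hm : 2 ≤ m) :
    Summable fun i : ℕ => epsilonTerm m (i + 1) := by
  simp only [epsilonTerm_eq_raney (one_le_two.trans hm)]
  exact (summable_raney (by positivity) (by norm_num) (half_pow_supersolution hm) m).mul_left _

/-- The number `φ = 2 (1 - ε_m)` is the root in `(1, 2)` of `(2 - x) x ^ m = 1`, that is, of
`x ^ m = x ^ (m - 1) + ⋯ + 1`. -/
theorem two_mul_one_sub_epsilon {m : ℕ} (hm : 2 ≤ m) :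
    1 < 2 * (1 - epsilon m) ∧ 2 * (1 - epsilon m) < 2 ∧
      (2 - 2 * (1 - epsilon m)) * (2 * (1 - epsilon m)) ^ m = 1 := by
  have hs := half_pow_supersolution hm
  set t : ℝ := (1 / 2) ^ (m + 1) with ht
  have ht0 : 0 < t := by positivity
  have hb : (0 : ℝ) ≤ 3 / 2 := by norm_num
  set B : ℝ := ∑' j, (raney (m + 1) j 1 : ℝ) * t ^ j with hB
  have hB1 : B = 1 + t * B ^ (m + 1) := tsum_raney_one ht0.le hb hs
  have hB0 : 0 ≤ B := tsum_nonneg fun j => by positivity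
  have hB2 : B ≤ 3 / 2 := by
    refine Real.tsum_le_of_sum_range_le (fun j => by positivity) fun n => ?_
    refine le_trans ?_ ((sum_raney_le ht0.le hb hs n 1).trans_eq (pow_one _))
    exact Finset.sum_le_sum_of_subset_of_nonneg (Finset.range_mono n.le_succ)
      fun j _ _ => by positivity
  have hε : epsilon m = t * B ^ m := by
    simp only [epsilon, epsilonTerm_eq_raney (one_le_two.trans hm)]
    rw [tsum_mul_left, tsum_raney_eq_pow ht0.le hb hs]
  have hBpos : 1 < B := by
    have h1 : 1 ≤ B := by rw [hB1]; linarith [mul_nonneg ht0.le (pow_nonneg hB0 (m + 1))]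
    rw [hB1]
    linarith [mul_pos ht0 (pow_pos (one_pos.trans_le h1) (m + 1))]
  have hφ : 2 * (1 - epsilon m) = 2 / B := by
    rw [hε]
    field_simp
    linear_combination hB1
  rw [hφ]
  refine ⟨?_, ?_, ?_⟩
  · rw [lt_div_iff₀ (by linarith)]; linarith
  · rw [div_lt_iff₀ (by linarith)]; linarith
  · have h2 : B - 1 = B ^ (m + 1) / 2 ^ (m + 1) := by
      rw [sub_eq_iff_eq_add'.2 hB1, ht, one_div_pow]
      ring
    have : 2 - 2 / B = 2 * (B - 1) / B := by field_simp
    rw [this, h2, div_pow]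
    field_simp
    ring

/-! ### Words with short runs -/

variable {α : Type*}

/-- The two sides of the partition of the alphabet: `I` for `true`, its complement for `false`. -/
def side (I : Set α) : Bool → Set α
  | true => I
  | false => Iᶜ

theorem side_not (I : Set α) (s : Bool) : side I (!s) = (side I s)ᶜ := by
  cases s <;> simp [side]

/-- `Continues k I s r w`: the word `w` may follow a run of exactly `r` letters of side `s`, in the
sense that no run (the given one included) reaches length `k` and that the last letter of the whole
word is not in `I`. For empty `w` that last letter is of side `s`. -/
def Continues (k : ℕ) (I : Set α) : Bool → ℕ → List α → Prop
  | s, _, [] => s = false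
  | s, r, a :: w => (a ∈ side I s ∧ r + 1 < k ∧ Continues k I s (r + 1) w) ∨
      (a ∈ side I (!s) ∧ Continues k I (!s) 1 w)

theorem isFree_cons (k : ℕ) (C : Set (List α)) (a : α) (x : List α) :
    IsFree k C (a :: x) ↔ (k ≤ x.length + 1 → (a :: x).take k ∉ C) ∧ IsFree k C x := by
  constructor
  · intro h
    refine ⟨fun hk => by simpa using h 0 (by simpa using hk), fun i hi => ?_⟩
    simpa using h (i + 1) (by simp; omega)
  · rintro ⟨h0, h⟩ (_ | i) hi
    · simpa using h0 (by simpa using hi)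
    · simpa using h i (by simp at hi; omega)

/-- A run shorter than `k` may be cut off in front of a letter of the other side: a window of length
`k` that begins inside the run contains letters of both sides. -/
theorem isFree_append_cons {k : ℕ} {I : Set α} {s : Bool} {u : List α} {a : α} (w : List α)
    (hu : ∀ b ∈ u, b ∈ side I s) (huk : u.length < k) (ha : a ∈ side I (!s)) :
    IsFree k (pow I k ∪ pow Iᶜ k) (u ++ a :: w) ↔ IsFree k (pow I k ∪ pow Iᶜ k) (a :: w) := by
  induction u with
  | nil => simp
  | cons b u ih =>
    rw [List.cons_append, isFree_cons,
      ih (fun c hc => hu c (List.mem_cons_of_mem _ hc)) (by simp at huk; omega)]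
    refine and_iff_right fun _ hmem => ?_
    have hb : b ∈ side I s := hu b List.mem_cons_self
    obtain ⟨j, rfl⟩ : ∃ j, k = j + 1 + u.length + 1 :=
      ⟨k - u.length - 2, by simp at huk; omega⟩
    have hbm : b ∈ (b :: (u ++ a :: w)).take (j + 1 + u.length + 1) := by simp
    have ham : a ∈ (b :: (u ++ a :: w)).take (j + 1 + u.length + 1) := by
      simp [List.take_append]
    rw [side_not] at ha
    cases s
    · rcases hmem with h | h
      · exact hb (h.2 _ hbm)
      · exact ha (h.2 _ ham)
    · rcases hmem with h | h
      · exact ha (h.2 _ ham)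
      · exact h.2 _ hbm hb

/-- `Continues` describes the free words with last letter outside `I` that begin with the letters
`u` of one side. -/
theorem continues_iff {k : ℕ} {I : Set α} (w : List α) {s : Bool} {u : List α}
    (hu : ∀ b ∈ u, b ∈ side I s) (hu0 : u ≠ []) (huk : u.length < k) :
    Continues k I s u.length w ↔
      IsFree k (pow I k ∪ pow Iᶜ k) (u ++ w) ∧ ∃ b ∈ (u ++ w).getLast?, b ∈ Iᶜ := by
  induction w generalizing s u with
  | nil =>
    have h1 : IsFree k (pow I k ∪ pow Iᶜ k) (u ++ []) := fun i hi => by simp at hi; omega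
    rw [and_iff_right h1, List.append_nil, List.getLast?_eq_getLast_of_ne_nil hu0]
    have := hu _ (List.getLast_mem hu0)
    cases s <;> simpa [Continues, side] using this
  | cons a w ih =>
    rw [Continues]
    by_cases ha : a ∈ side I s
    · have hna : a ∉ side I (!s) := by rw [side_not]; exact fun h => h ha
      have hu' : ∀ b ∈ u ++ [a], b ∈ side I s := by
        intro b hb
        rcases List.mem_append.1 hb with hb | hb
        · exact hu b hb
        · rwa [List.mem_singleton.1 hb]
      by_cases hr : u.length + 1 < k
      · have := ih hu' (by simp) (by simpa using hr)
        simpa [ha, hna, hr] using this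
      · -- The letter `a` completes a window of `k` letters of side `s`.
        refine iff_of_false (by simp [hna, hr]) fun h => ?_
        have hk : k = (u ++ [a]).length := by simp; omega
        refine h.1 0 (by simp; omega) ?_
        have e : ((u ++ a :: w).drop 0).take k = u ++ [a] := by
          rw [hk, List.drop_zero, show u ++ a :: w = (u ++ [a]) ++ w by simp,
            List.take_left]
        rw [e]
        cases s
        · exact Or.inr ⟨hk.symm, hu'⟩
        · exact Or.inl ⟨hk.symm, hu'⟩
    · have ha' : a ∈ side I (!s) := by rw [side_not]; exact ha
      have := ih (s := !s) (u := [a]) (by simpa using ha') (by simp)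
        (by have := List.length_pos_iff.2 hu0; simp; omega)
      rw [isFree_append_cons w hu huk ha']
      simpa [ha, ha'] using this

/-! ### Counting words -/

theorem ncard_image2_of_injOn {β γ : Type*} {f : α → β → γ} {A : Set α} {B : Set β}
    (h : Set.InjOn (fun p : α × β => f p.1 p.2) (A ×ˢ B)) :
    (Set.image2 f A B).ncard = A.ncard * B.ncard := by
  rw [← Set.image_prod, h.ncard_image, Set.ncard_prod]

theorem ncard_image2_cons (A : Set α) (B : Set (List α)) :
    (Set.image2 List.cons A B).ncard = A.ncard * B.ncard :=
  ncard_image2_of_injOn fun p _ p' _ h => by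
    obtain ⟨h1, h2⟩ := List.cons_eq_cons.1 h
    exact Prod.ext h1 h2

theorem ncard_image2_append {A B : Set (List α)} {l : ℕ} (hA : ∀ x ∈ A, x.length = l) :
    (Set.image2 (· ++ ·) A B).ncard = A.ncard * B.ncard :=
  ncard_image2_of_injOn fun p hp p' hp' h => by
    obtain ⟨h1, h2⟩ := List.append_inj h ((hA _ hp.1).trans (hA _ hp'.1).symm)
    exact Prod.ext h1 h2

theorem ncard_pow (A : Set α) (k : ℕ) : (pow A k).ncard = A.ncard ^ k := by
  induction k with
  | zero =>
    have : pow A 0 = {[]} := by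
      ext w
      simp only [pow, Set.mem_ofPred_eq, List.length_eq_zero_iff, Set.mem_singleton_iff]
      exact ⟨fun h => h.1, fun h => by simp [h]⟩
    simp [this]
  | succ k ih =>
    have : pow A (k + 1) = Set.image2 List.cons A (pow A k) := by
      ext w
      cases w with
      | nil => simp [pow]
      | cons a w => simp [pow]; tauto
    rw [this, ncard_image2_cons, ih, pow_succ']

/-- The words of length `L` that may follow a run of `r` letters of side `s`. -/
def continuations (k : ℕ) (I : Set α) (s : Bool) (r L : ℕ) : Set (List α) :=
  {w | w.length = L ∧ Continues k I s r w}

theorem continuations_finite [Finite α] (k : ℕ) (I : Set α) (s : Bool) (r L : ℕ) :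
    (continuations k I s r L).Finite :=
  (List.finite_length_eq α L).subset fun _ hw => hw.1

theorem ncard_continuations_zero (k : ℕ) (I : Set α) (s : Bool) (r : ℕ) :
    (continuations k I s r 0).ncard = if s = false then 1 else 0 := by
  split_ifs with hs
  · have : continuations k I s r 0 = {[]} := by
      ext w
      cases w <;> simp [continuations, Continues, hs]
    simp [this]
  · have : continuations k I s r 0 = ∅ := by
      ext w
      cases w <;> simp [continuations, Continues, hs]
    simp [this]

/-- The next letter either prolongs the current run, if that is still allowed, or starts a run of
length `1` on the other side. -/
theorem ncard_continuations_succ [Finite α] {I : Set α} (hI : I.ncard = Iᶜ.ncard) (k : ℕ)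
    (s : Bool) (r L : ℕ) :
    (continuations k I s r (L + 1)).ncard =
      (if r + 1 < k then I.ncard * (continuations k I s (r + 1) L).ncard else 0) +
        I.ncard * (continuations k I (!s) 1 L).ncard := by
  have hside : ∀ s, (side I s).ncard = I.ncard := by
    intro s
    cases s
    · exact hI.symm
    · rfl
  have hset : continuations k I s r (L + 1) =
      (if r + 1 < k then Set.image2 List.cons (side I s) (continuations k I s (r + 1) L) else ∅) ∪
        Set.image2 List.cons (side I (!s)) (continuations k I (!s) 1 L) := by
    ext w
    cases w with
    | nil => split_ifs <;> simp [continuations]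
    | cons a w =>
      split_ifs with hr <;> simp [continuations, Continues, hr]
      · tauto
      · tauto
  have hfin : ∀ s s' r', (Set.image2 List.cons (side I s) (continuations k I s' r' L)).Finite :=
    fun s s' r' => (Set.toFinite _).image2 _ (continuations_finite k I s' r' L)
  rw [hset, Set.ncard_union_eq ?_ (by split_ifs <;> simp [hfin]) (hfin _ _ _)]
  · rw [ncard_image2_cons, hside]
    split_ifs
    · rw [ncard_image2_cons, hside]
    · simp
  · split_ifs
    · rw [Set.disjoint_left]
      rintro _ ⟨a, ha, w, _, rfl⟩ ⟨a', ha', w', _, h⟩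
      obtain ⟨rfl, -⟩ := List.cons_eq_cons.1 h
      rw [side_not] at ha'
      exact ha' ha
    · simp

/-- A block is a word of `J^k`, a letter of `I`, a continuation of the run of length `1` formed by
that letter, and a word of `I^k`. -/
theorem ncard_block {q : ℕ} {I : Set (Fin q)} (hI : I.ncard = Iᶜ.ncard) {k : ℕ} (hk : 2 ≤ k)
    (L : ℕ) : (block I Iᶜ k (2 * k + 1 + (L + 1))).ncard =
      I.ncard ^ (2 * k + 1) * (continuations k I true 1 (L + 1)).ncard := by
  have hset : block I Iᶜ k (2 * k + 1 + (L + 1)) =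
      Set.image2 (· ++ ·) (pow Iᶜ k) (Set.image2 (· ++ ·)
        (Set.image2 List.cons I (continuations k I true 1 (L + 1))) (pow I k)) := by
    ext v
    constructor
    · rintro ⟨hlen, h1, h2, h3, h4, h5⟩
      refine ⟨v.take k, h1, v.drop k, ⟨(v.drop k).take (L + 2), ?_, v.drop (k + (L + 2)), ?_, ?_⟩,
        List.take_append_drop _ _⟩
      · rw [show 2 * k + 1 + (L + 1) - 2 * k = L + 2 by omega] at h5
        rw [show 2 * k + 1 + (L + 1) - k - 1 = k + (L + 1) by omega] at h3
        have hx : ((v.drop k).take (L + 2)).length = L + 2 := by simp; omega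
        have h2' : ∃ a ∈ ((v.drop k).take (L + 2))[0]?, a ∈ I := by
          simpa [List.getElem?_take, List.getElem?_drop] using h2
        have h3' : ∃ b ∈ ((v.drop k).take (L + 2)).getLast?, b ∈ Iᶜ := by
          rw [List.getLast?_eq_getElem?, hx]
          simpa [List.getElem?_take, List.getElem?_drop] using h3
        generalize (v.drop k).take (L + 2) = x at *
        cases x with
        | nil => simp at hx
        | cons a w =>
          have ha : a ∈ I := by simpa using h2'
          refine ⟨a, ha, w, ⟨by simpa using hx, ?_⟩, rfl⟩
          exact (continues_iff (u := [a]) (s := true) w (by simpa [side] using ha) (by simp)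
            (by simp; omega)).2 ⟨h5, h3'⟩
      · rwa [show 2 * k + 1 + (L + 1) - k = k + (L + 2) by omega] at h4
      · rw [← List.drop_drop (i := L + 2)]
        exact List.take_append_drop _ _
    · rintro ⟨u, hu, _, ⟨_, ⟨a, ha, w, ⟨hw, hc⟩, rfl⟩, z, hz, rfl⟩, rfl⟩
      obtain ⟨hfree, hlast⟩ := (continues_iff (u := [a]) (s := true) w
        (by simpa [side] using ha) (by simp) (by simp; omega)).1 hc
      have hul := hu.1
      have hzl := hz.1
      rw [List.getLast?_eq_getElem?] at hlast
      simp only [List.singleton_append, List.length_cons, hw, Nat.add_sub_cancel] at hlast hfree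
      have hd : (u ++ (a :: w ++ z)).drop k = a :: w ++ z := by rw [← hul, List.drop_left]
      refine ⟨by simp; omega, ?_, ⟨a, ?_, ha⟩, ?_, ?_, ?_⟩
      · rwa [← hul, List.take_left, hul]
      · simp [hul]
      · rw [show 2 * k + 1 + (L + 1) - k - 1 = k + (L + 1) by omega, ← List.getElem?_drop, hd,
          List.getElem?_append_left (by simp; omega)]
        exact hlast
      · rw [show 2 * k + 1 + (L + 1) - k = k + (L + 2) by omega, ← List.drop_drop, hd,
          show L + 2 = (a :: w).length by simp; omega, List.drop_left]
        exact hz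
      · rw [hd, show 2 * k + 1 + (L + 1) - 2 * k = (a :: w).length by simp; omega, List.take_left]
        exact hfree
  have hlen : ∀ x ∈ Set.image2 List.cons I (continuations k I true 1 (L + 1)),
      x.length = L + 2 := by
    rintro _ ⟨a, _, w, hw, rfl⟩
    simpa using hw.1
  rw [hset, ncard_image2_append fun x hx => hx.1, ncard_image2_append hlen, ncard_image2_cons,
    ncard_pow, ncard_pow, ← hI]
  ring

/-! ### Growth rate -/

/-- The potential `p r = φ - (2 - φ) φ ^ r` satisfies `φ p r = p (r + 1) + p 1`, the eigenvector
equation of the recursion for the number of continuations. -/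
theorem potential_step {φ : ℝ} (r : ℕ) :
    φ * (φ - (2 - φ) * φ ^ r) = (φ - (2 - φ) * φ ^ (r + 1)) + (φ - (2 - φ) * φ ^ 1) := by
  ring

theorem potential_eq_zero {φ : ℝ} {k : ℕ} (hk : 1 ≤ k) (h : (2 - φ) * φ ^ (k - 1) = 1) :
    φ - (2 - φ) * φ ^ k = 0 := by
  obtain ⟨m, rfl⟩ := Nat.exists_eq_add_of_le' hk
  rw [Nat.add_sub_cancel] at h
  linear_combination (-φ) * h

theorem ncard_continuations_le [Finite α] {I : Set α} (hI : I.ncard = Iᶜ.ncard) {k : ℕ}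
    {φ : ℝ} (h1 : 1 < φ) (h2 : φ < 2) (h : (2 - φ) * φ ^ (k - 1) = 1) (s : Bool) {r : ℕ}
    (hr : r < k) (L : ℕ) :
    (φ - 1) * (continuations k I s r L).ncard ≤ (φ - (2 - φ) * φ ^ r) * (I.ncard * φ) ^ L := by
  induction L generalizing s r with
  | zero =>
    -- The potential decreases in `r`, and its last value `p (k - 1)` is `φ - 1`.
    have hp : (2 - φ) * φ ^ r ≤ 1 := by
      rw [← h]
      exact mul_le_mul_of_nonneg_left (pow_le_pow_right₀ h1.le (by omega)) (by linarith)
    have hc : ((continuations k I s r 0).ncard : ℝ) ≤ 1 := by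
      rw [ncard_continuations_zero]
      split_ifs <;> simp
    rw [pow_zero, mul_one]
    nlinarith
  | succ L ih =>
    have hJ := mul_le_mul_of_nonneg_left (ih (s := !s) (r := 1) ?_)
      (Nat.cast_nonneg (α := ℝ) I.ncard)
    · rw [ncard_continuations_succ hI]
      have hp := potential_step (φ := φ) r
      split_ifs with hrk
      · have hK := mul_le_mul_of_nonneg_left (ih (s := s) hrk) (Nat.cast_nonneg (α := ℝ) I.ncard)
        push_cast
        calc _ = _ := by rw [mul_add, mul_left_comm, mul_left_comm (φ - 1)]
          _ ≤ _ := add_le_add hK hJ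
          _ = _ := by rw [pow_succ]; linear_combination (-(I.ncard : ℝ) * (I.ncard * φ) ^ L) * hp
      · have hz := potential_eq_zero (by omega) h
        rw [show k = r + 1 by omega] at hz
        rw [hz] at hp
        push_cast
        calc _ = _ := by rw [zero_add, mul_left_comm]
          _ ≤ _ := hJ
          _ = _ := by rw [pow_succ]; linear_combination (-(I.ncard : ℝ) * (I.ncard * φ) ^ L) * hp
    · -- For `k ≤ 1` the equation for `φ` would read `2 - φ = 1`.
      by_contra hk
      have : k - 1 = 0 := by omega
      rw [this] at h
      linarith

/-- Length `2` is the first at which every state has a continuation: a run of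
`k - 1` letters outside `I` must be followed by a letter of `I`, which cannot be the last one. -/
theorem one_le_ncard_continuations_two [Finite α] {I : Set α} (hI : I.ncard = Iᶜ.ncard)
    (hpos : 1 ≤ I.ncard) {k : ℕ} (hk : 3 ≤ k) (s : Bool) (r : ℕ) :
    1 ≤ (continuations k I s r 2).ncard := by
  rw [ncard_continuations_succ hI]
  refine le_add_left ?_
  rw [ncard_continuations_succ hI, if_pos (by omega : 1 + 1 < k)]
  have : 1 ≤ I.ncard * (continuations k I (!s) (1 + 1) 0).ncard +
      I.ncard * (continuations k I (!!s) 1 0).ncard := by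
    cases s <;> simp [ncard_continuations_zero] <;> omega
  exact Nat.mul_pos hpos this

theorem le_ncard_continuations [Finite α] {I : Set α} (hI : I.ncard = Iᶜ.ncard)
    (hpos : 1 ≤ I.ncard) {k : ℕ} (hk : 3 ≤ k)
    {φ : ℝ} (h1 : 1 < φ) (h2 : φ < 2) (h : (2 - φ) * φ ^ (k - 1) = 1) (s : Bool) {r : ℕ}
    (hr : r < k) (L : ℕ) :
    (φ - (2 - φ) * φ ^ r) * (I.ncard * φ) ^ L ≤ 2 * (continuations k I s r (L + 2)).ncard := by
  induction L generalizing s r with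
  | zero =>
    have hp : 0 ≤ (2 - φ) * φ ^ r := mul_nonneg (by linarith) (by positivity)
    have hc : (1 : ℝ) ≤ (continuations k I s r (0 + 2)).ncard := by
      exact_mod_cast one_le_ncard_continuations_two hI hpos hk s r
    rw [pow_zero, mul_one]
    linarith
  | succ L ih =>
    have hJ := mul_le_mul_of_nonneg_left (ih (s := !s) (r := 1) (by omega))
      (Nat.cast_nonneg (α := ℝ) I.ncard)
    rw [show L + 1 + 2 = L + 2 + 1 by ring, ncard_continuations_succ hI]
    have hp := potential_step (φ := φ) r
    split_ifs with hrk
    · have hK := mul_le_mul_of_nonneg_left (ih (s := s) hrk) (Nat.cast_nonneg (α := ℝ) I.ncard)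
      push_cast
      calc _ = _ := by rw [pow_succ]; linear_combination ((I.ncard : ℝ) * (I.ncard * φ) ^ L) * hp
        _ ≤ _ := add_le_add hK hJ
        _ = _ := by ring
    · have hz := potential_eq_zero (by omega) h
      rw [show k = r + 1 by omega] at hz
      rw [hz] at hp
      push_cast
      calc _ = _ := by rw [pow_succ]; linear_combination ((I.ncard : ℝ) * (I.ncard * φ) ^ L) * hp
        _ ≤ _ := hJ
        _ = _ := by ring

/-- A polynomial factor does not change the exponential growth rate. -/
theorem tendsto_rpow_one_div_of_le {a : ℕ → ℝ} {c K ρ : ℝ} (hc : 0 < c) (hρ : 0 < ρ)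
    (hl : ∀ᶠ n : ℕ in Filter.atTop, c * ρ ^ n ≤ a n)
    (hu : ∀ᶠ n : ℕ in Filter.atTop, a n ≤ K * n * ρ ^ n) :
    Filter.Tendsto (fun n : ℕ => a n ^ (1 / (n : ℝ))) Filter.atTop (nhds ρ) := by
  have hroot : ∀ x : ℝ, 0 < x →
      Filter.Tendsto (fun n : ℕ => x ^ (1 / (n : ℝ))) Filter.atTop (nhds 1) := by
    intro x hx
    simpa using tendsto_const_nhds.rpow (tendsto_one_div_atTop_nhds_zero_nat (𝕜 := ℝ))
      (Or.inl hx.ne')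
  have hnn : Filter.Tendsto (fun n : ℕ => (n : ℝ) ^ (1 / (n : ℝ))) Filter.atTop (nhds 1) :=
    tendsto_rpow_div.comp tendsto_natCast_atTop_atTop
  have hpow : ∀ n : ℕ, n ≠ 0 → (ρ ^ n) ^ (1 / (n : ℝ)) = ρ := by
    intro n hn
    rw [one_div, Real.pow_rpow_inv_natCast hρ.le hn]
  have hK : 0 < max K 1 := by positivity
  have hlow := (hroot c hc).mul_const ρ
  have hupp := ((hroot _ hK).mul hnn).mul_const ρ
  simp only [one_mul] at hlow hupp
  refine tendsto_of_tendsto_of_tendsto_of_le_of_le' hlow hupp ?_ ?_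
  · filter_upwards [hl, Filter.eventually_ne_atTop 0] with n hn hn0
    calc c ^ (1 / (n : ℝ)) * ρ = (c * ρ ^ n) ^ (1 / (n : ℝ)) := by
          rw [Real.mul_rpow hc.le (by positivity), hpow n hn0]
      _ ≤ _ := Real.rpow_le_rpow (by positivity) hn (by positivity)
  · filter_upwards [hl, hu, Filter.eventually_ne_atTop 0] with n hn hn' hn0
    calc a n ^ (1 / (n : ℝ)) ≤ (max K 1 * n * ρ ^ n) ^ (1 / (n : ℝ)) := by
          refine Real.rpow_le_rpow (le_trans (by positivity) hn) (hn'.trans ?_) (by positivity)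
          gcongr
          exact le_max_left _ _
      _ = _ := by
          rw [Real.mul_rpow (by positivity) (by positivity), hpow n hn0,
            Real.mul_rpow (by positivity) (by positivity)]

theorem tendsto_ncard_code {q k : ℕ} {I : Set (Fin q)} (hI : I.ncard = Iᶜ.ncard)
    (hpos : 1 ≤ I.ncard) (hk : 3 ≤ k) {φ : ℝ} (h1 : 1 < φ) (h2 : φ < 2)
    (h : (2 - φ) * φ ^ (k - 1) = 1) :
    Filter.Tendsto (fun n : ℕ => ((code I Iᶜ k n).ncard : ℝ) ^ (1 / (n : ℝ))) Filter.atTop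
      (nhds (I.ncard * φ)) := by
  have hI1 : (1 : ℝ) ≤ I.ncard := by exact_mod_cast hpos
  have hρ : 1 < I.ncard * φ := by nlinarith
  set ρ : ℝ := I.ncard * φ with hρdef
  have hρ0 : 0 < ρ := by linarith
  have hp1 : φ - (2 - φ) * φ ^ 1 = φ * (φ - 1) := by ring
  have hφ : 0 < φ * (φ - 1) := mul_pos (by linarith) (by linarith)
  have hh : (0 : ℝ) < (I.ncard : ℝ) ^ (2 * k + 1) := by positivity
  have hblock : ∀ i, 2 * k + 2 ≤ i →
      ((block I Iᶜ k i).ncard : ℝ) ≤ (I.ncard : ℝ) ^ (2 * k + 1) * φ * ρ ^ i := by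
    intro i hi
    obtain ⟨L, rfl⟩ : ∃ L, i = 2 * k + 1 + (L + 1) := ⟨i - (2 * k + 2), by omega⟩
    rw [ncard_block hI (by omega)]
    have hc := ncard_continuations_le hI h1 h2 h true (show 1 < k by omega) (L + 1)
    rw [hp1, mul_right_comm, mul_comm] at hc
    have hc' := le_of_mul_le_mul_right hc (by linarith)
    push_cast
    rw [mul_assoc]
    refine mul_le_mul_of_nonneg_left (hc'.trans ?_) hh.le
    exact mul_le_mul_of_nonneg_left (pow_le_pow_right₀ hρ.le (by omega)) (by linarith)
  refine tendsto_rpow_one_div_of_le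
    (c := (I.ncard : ℝ) ^ (2 * k + 1) * (φ * (φ - 1) / 2) / ρ ^ (2 * k + 3))
    (K := (I.ncard : ℝ) ^ (2 * k + 1) * φ) (by positivity) hρ0 ?_ ?_
  · -- From below, the codewords of length exactly `n` suffice. A block of length `L + (2 * k + 3)`
    -- contains a continuation of length `L + 2`, to which `le_ncard_continuations` applies.
    filter_upwards [Filter.eventually_ge_atTop (2 * k + 3)] with n hn
    have hsub : block I Iᶜ k n ⊆ code I Iᶜ k n :=
      Set.subset_biUnion_of_mem (u := fun i => block I Iᶜ k i) (Set.mem_Icc.2 ⟨by omega, le_rfl⟩)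
    have hle : ((block I Iᶜ k n).ncard : ℝ) ≤ (code I Iᶜ k n).ncard := by
      exact_mod_cast Set.ncard_le_ncard hsub (code_finite I Iᶜ k n)
    refine le_trans ?_ hle
    obtain ⟨L, rfl⟩ : ∃ L, n = 2 * k + 1 + (L + 1 + 1) := ⟨n - (2 * k + 3), by omega⟩
    rw [ncard_block hI (by omega)]
    have hc := le_ncard_continuations hI hpos hk h1 h2 h true (show 1 < k by omega) L
    rw [hp1] at hc
    rw [show 2 * k + 1 + (L + 1 + 1) = L + (2 * k + 3) by ring, pow_add ρ L, div_mul_eq_mul_div,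
      mul_div_assoc, mul_div_cancel_right₀ _ (pow_pos hρ0 _).ne']
    push_cast
    rw [mul_assoc]
    refine mul_le_mul_of_nonneg_left ?_ hh.le
    linarith
  · filter_upwards with n
    have hcard : (code I Iᶜ k n).ncard ≤
        ∑ i ∈ Finset.Icc (2 * k + 2) n, (block I Iᶜ k i).ncard := by
      have hcode : code I Iᶜ k n = ⋃ i ∈ Finset.Icc (2 * k + 2) n, block I Iᶜ k i := by
        simp [code]
      rw [hcode]
      exact Finset.set_ncard_biUnion_le _ _
    calc ((code I Iᶜ k n).ncard : ℝ)
        ≤ ∑ i ∈ Finset.Icc (2 * k + 2) n, ((block I Iᶜ k i).ncard : ℝ) := by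
          exact_mod_cast hcard
      _ ≤ ∑ i ∈ Finset.Icc (2 * k + 2) n, (I.ncard : ℝ) ^ (2 * k + 1) * φ * ρ ^ n := by
          refine Finset.sum_le_sum fun i hi => ?_
          obtain ⟨hi1, hi2⟩ := Finset.mem_Icc.1 hi
          refine (hblock i hi1).trans ?_
          exact mul_le_mul_of_nonneg_left (pow_le_pow_right₀ hρ.le hi2) (by positivity)
      _ ≤ n * ((I.ncard : ℝ) ^ (2 * k + 1) * φ * ρ ^ n) := by
          rw [Finset.sum_const, nsmul_eq_mul, Nat.card_Icc]
          refine mul_le_mul_of_nonneg_right ?_ (by positivity)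
          exact_mod_cast (by omega : n + 1 - (2 * k + 2) ≤ n)
      _ = _ := by ring

end NonOverlapping

theorem mainTheorem8 (q k : ℕ) (hq : 2 ≤ q) (hk : 8 ≤ 2 * k + 2)
    (I J : Set (Fin q)) (hIJ : I ∪ J = Set.univ) (hdisj : Disjoint I J)
    (hcard : I.ncard = J.ncard) :
    Summable (fun i : ℕ => NonOverlapping.epsilonTerm (k - 1) (i + 1)) ∧
    Filter.limsup
      (fun n : ℕ => ((((NonOverlapping.code I J k n).ncard : ℝ) ^ (1 / (n : ℝ)) : ℝ) : EReal))
      Filter.atTop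
      = (((q : ℝ) * (1 - NonOverlapping.epsilon (k - 1)) : ℝ) : EReal) := by
  have hm : 2 ≤ k - 1 := by omega
  refine ⟨NonOverlapping.summable_epsilonTerm hm, ?_⟩
  obtain rfl : J = Iᶜ := (IsCompl.of_eq hdisj.eq_bot hIJ).compl_eq.symm
  have hsum := Set.ncard_add_ncard_compl I
  rw [← hcard, Nat.card_eq_fintype_card, Fintype.card_fin] at hsum
  obtain ⟨h1, h2, h⟩ := NonOverlapping.two_mul_one_sub_epsilon hm
  have hlim := NonOverlapping.tendsto_ncard_code hcard (by omega) (by omega) h1 h2 h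
  have hq' : (q : ℝ) * (1 - NonOverlapping.epsilon (k - 1)) =
      I.ncard * (2 * (1 - NonOverlapping.epsilon (k - 1))) := by
    have hsum' : (I.ncard : ℝ) + I.ncard = q := by exact_mod_cast hsum
    rw [← hsum']
    ring
  rw [hq']
  exact ((continuous_coe_real_ereal.tendsto _).comp hlim).limsup_eq
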